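/- Let $n\ge 1$ and let $\mathbb{R}_n$ be the real Clifford algebra over the imaginary units $e_1,\dots,e_n$ ($e_i^2=-1$, $e_ie_j=-e_je_i$ for $i\ne j$), with the Euclidean norm $|a|^2=\sum_A |a_A|^2$ of $a=\sum_A a_Ae_A$. Identify $(x_0,\dots,x_n)\in\mathbb{R}^{n+1}$ with the paravector $x=x_0+\sum_{\ell=1}^n x_\ell e_\ell$, and let $\mathbb{S}=\{\sum_\ell x_\ell e_\ell : \sum_\ell x_\ell^2=1\}$. A function $f:\mathbb{R}^{n+1}\to\mathbb{R}_n$ is called entire left (resp. right) slice monogenic if there are real differentiable $f_0,f_1:\mathbb{R}^2\to\mathbb{R}_n$ with $f_0(u,-v)=f_0(u,v)$, $f_1(u,-v)=-f_1(u,v)$, $\partial_uf_0-\partial_vf_1=0$, $\partial_vf_0+\partial_uf_1=0$, such that $f(u+\mathbf{j}v)=f_0(u,v)+\mathbf{j}f_1(u,v)$ (resp. $f(u+\mathbf{j}v)=f_0(u,v)+f_1(u,v)\mathbf{j}$) for all $u,v\in\mathbb{R}$, $\mathbf{j}\in\mathbb{S}$. Such an $f$ has a power series $f(x)=\sum_k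 x^ka_k$ (resp. $\sum_k a_kx^k$) with $a_k=\frac1{k!}\partial_{x_0}^kf(0)$. If $g$ is a function of the same kind with coefficients $b_k$, put $$(f\star_L g)(x)=\sum_{\ell=0}^\infty x^\ell\sum_{k=0}^\ell a_kb_{\ell-k},\qquad \Big(\text{resp. } (f\star_R g)(x)=\sum_{\ell=0}^\infty\Big(\sum_{k=0}^\ell a_kb_{\ell-k}\Big)x^\ell\Big).$$ Let $p\ge1$ and $1/q=1-1/p$ (so $1/q=0$ when $p=1$). Let $\mathcal{SM}^p_L$ (resp. $\mathcal{SM}^p_R$) be the set of entire left (resp. right) slice monogenic functions $f$ for which there are $B,C>0$ with $|f(x)|\le Ce^{B|x|^p}$ for all $x$. In these spaces, $f_k\to f$ means that for some $B>0$, $\lim_{k\to\infty}\sup_{x\in\mathbb{R}^{n+1}}|(f_k(x)-f(x))e^{-B|x|^p}|=0$. (I) Let $(u_m)_{m\ge0}$ be entire left slice monogenic functions for which there is $B>0$ such that for every $\varepsilon>0$ there is $C_\varepsilon>0$ with $$|u_m(x)|\le C_\varepsilon\frac{\varepsilon^m}{(m!)^{1/q}}e^{B|x|^p}\qquad\text{for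 all } m\ge0,\ x\in\mathbb{R}^{n+1}.$$ Then for every $f\in\mathcal{SM}^p_L$ the series $U_Lf(x)=\sum_{m=0}^\infty u_m(x)\star_L\partial_{x_0}^mf(x)$ converges absolutely for every $x$ (as do the series defining its star products), and $U_Lf\in\mathcal{SM}^p_L$. Moreover $U_L$ acts continuously on $\mathcal{SM}^p_L$: if $f_k\in\mathcal{SM}^p_L$ and $f_k\to0$, then $U_Lf_k\to0$; and, more generally, if $f_k,f\in\mathcal{SM}^p_L$ and $f_k\to f$, then $U_Lf_k\to U_Lf$. (II) The same holds for right slice monogenic coefficients $u_m$ satisfying the same bounds, with $\mathcal{SM}^p_R$, $\star_R$ and $U_Rf=\sum_{m=0}^\infty u_m\star_R\partial_{x_0}^mf$ in place of $\mathcal{SM}^p_L$, $\star_L$ and $U_L$. -/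

import Mathlib

open Filter Topology
open scoped symmDiff

namespace SliceMonogenic

noncomputable section

/-! ### The real Clifford algebra `ℝ_n` -/

/-- The quadratic form `v ↦ -(v₁² + ⋯ + v_n²)` on `ℝⁿ`. -/
def cliffordForm (n : ℕ) : QuadraticForm ℝ (Fin n → ℝ) :=
  QuadraticMap.weightedSumSquares ℝ (fun _ : Fin n => (-1 : ℝ))

/-- The real Clifford algebra `ℝ_n` over `n` imaginary units, so that `e_i² = -1` and
`e_i e_j + e_j e_i = 0` for `i ≠ j`. -/
abbrev Cl (n : ℕ) : Type := CliffordAlgebra (cliffordForm n)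

/-- The imaginary unit `e_i`. -/
def e {n : ℕ} (i : Fin n) : Cl n := CliffordAlgebra.ι (cliffordForm n) (Pi.single i 1)

/-- The product `e_A = e_{i₁} ⋯ e_{i_r}` for `A = {i₁ < ⋯ < i_r}`, with `e_∅ = 1`. -/
def eProd {n : ℕ} (A : Finset (Fin n)) : Cl n := ((A.sort (· ≤ ·)).map e).prod

theorem cliffordForm_apply {n : ℕ} (v : Fin n → ℝ) : cliffordForm n v = -∑ i, v i * v i := by
  simp [cliffordForm, QuadraticMap.weightedSumSquares_apply]

theorem ι_eq_sum {n : ℕ} (v : Fin n → ℝ) :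
    CliffordAlgebra.ι (cliffordForm n) v = ∑ i, v i • e i := by
  conv_lhs => rw [pi_eq_sum_univ' v]
  simp [e, map_sum]

theorem e_sq {n : ℕ} (i : Fin n) : e i * e i = -1 := by
  rw [e, CliffordAlgebra.ι_sq_scalar, cliffordForm_apply]
  simp [Pi.single_apply]

theorem e_anticomm {n : ℕ} {i j : Fin n} (h : i ≠ j) : e i * e j = -(e j * e i) := by
  unfold e
  refine CliffordAlgebra.ι_mul_ι_comm_of_isOrtho ?_
  rw [QuadraticMap.isOrtho_def]
  simp only [cliffordForm_apply, Pi.add_apply, Pi.single_apply]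
  have h1 : ∀ x : Fin n, ((if x = i then (1 : ℝ) else 0) + (if x = j then 1 else 0)) *
      ((if x = i then (1 : ℝ) else 0) + (if x = j then 1 else 0)) =
      (if x = i then (1 : ℝ) else 0) * (if x = i then (1 : ℝ) else 0) +
      (if x = j then (1 : ℝ) else 0) * (if x = j then (1 : ℝ) else 0) := by
    intro x
    by_cases hi : x = i
    · subst hi; simp [h]
    · simp [hi]
  simp only [h1, Finset.sum_add_distrib]
  ring

theorem eProd_empty {n : ℕ} : eProd (∅ : Finset (Fin n)) = 1 := by simp [eProd]

theorem eProd_insert {n : ℕ} {a : Fin n} {s : Finset (Fin n)} (h : ∀ x ∈ s, a < x) :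
    eProd (insert a s) = e a * eProd s := by
  have ha : a ∉ s := fun h' => lt_irrefl _ (h a h')
  rw [eProd, Finset.sort_insert _ (fun b hb => (h b hb).le) ha]
  simp [eProd]

/-- Left multiplication by `e_i` permutes the `e_A` up to sign. -/
theorem e_mul_eProd {n : ℕ} (i : Fin n) (A : Finset (Fin n)) :
    ∃ c : ℝ, e i * eProd A = c • eProd (A ∆ {i}) := by
  induction A using Finset.induction_on_min generalizing i with
  | empty =>
    refine ⟨1, ?_⟩
    have h := eProd_insert (a := i) (s := ∅) (by simp)
    have h2 : (∅ : Finset (Fin n)) ∆ {i} = insert i ∅ := by ext; simp [Finset.mem_symmDiff]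
    rw [h2, h]; simp
  | insert a s has ih =>
    have ha : a ∉ s := fun h' => lt_irrefl _ (has a h')
    rcases lt_trichotomy i a with hia | hia | hia
    · refine ⟨1, ?_⟩
      have h1 : ∀ x ∈ insert a s, i < x := by
        intro x hx
        rcases Finset.mem_insert.1 hx with rfl | hx
        · exact hia
        · exact hia.trans (has x hx)
      have h2 : (insert a s) ∆ {i} = insert i (insert a s) := by
        have hi : i ∉ insert a s := fun h' => lt_irrefl _ (h1 i h')
        ext x; simp only [Finset.mem_symmDiff, Finset.mem_insert, Finset.mem_singleton] at hi ⊢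
        grind
      rw [h2, eProd_insert h1, one_smul]
    · subst hia
      refine ⟨-1, ?_⟩
      have h2 : (insert i s) ∆ {i} = s := by
        ext x; simp only [Finset.mem_symmDiff, Finset.mem_insert, Finset.mem_singleton]
        grind
      rw [h2, eProd_insert has, ← mul_assoc, e_sq]
      simp
    · obtain ⟨c, hc⟩ := ih i
      refine ⟨-c, ?_⟩
      have h1 : ∀ x ∈ s ∆ {i}, a < x := by
        intro x hx
        simp only [Finset.mem_symmDiff, Finset.mem_singleton] at hx
        grind
      have h2 : (insert a s) ∆ {i} = insert a (s ∆ {i}) := by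
        ext x; simp only [Finset.mem_symmDiff, Finset.mem_insert, Finset.mem_singleton]
        grind
      rw [h2, eProd_insert has, eProd_insert h1, ← mul_assoc, e_anticomm hia.ne', neg_mul,
        mul_assoc, hc]
      simp

theorem eProd_span {n : ℕ} : ⊤ ≤ Submodule.span ℝ (Set.range (eProd (n := n))) := by
  intro x _
  induction x using CliffordAlgebra.left_induction with
  | algebraMap r =>
    rw [Algebra.algebraMap_eq_smul_one, ← eProd_empty]
    exact Submodule.smul_mem _ _ (Submodule.subset_span ⟨_, rfl⟩)
  | add x y hx hy => exact Submodule.add_mem _ (hx trivial) (hy trivial)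
  | ι_mul x v hx =>
    replace hx := hx trivial
    rename_i h0
    clear h0
    induction hx using Submodule.span_induction with
    | mem y hy =>
      obtain ⟨A, rfl⟩ := hy
      rw [ι_eq_sum, Finset.sum_mul]
      refine Submodule.sum_mem _ fun i _ => ?_
      obtain ⟨c, hc⟩ := e_mul_eProd i A
      rw [smul_mul_assoc, hc]
      exact Submodule.smul_mem _ _ (Submodule.smul_mem _ _ (Submodule.subset_span ⟨_, rfl⟩))
    | zero => simp
    | add y z _ _ hy hz => rw [mul_add]; exact Submodule.add_mem _ hy hz
    | smul c y _ hy => rw [mul_smul_comm]; exact Submodule.smul_mem _ _ hy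

/-- The sign in `e_i e_A = ± e_{A ∆ {i}}`. -/
def repSign {n : ℕ} (i : Fin n) (A : Finset (Fin n)) : ℝ := ∏ j ∈ A, if j ≤ i then -1 else 1

/-- The operator `δ_A ↦ ± δ_{A ∆ {i}}`. -/
def repGen {n : ℕ} (i : Fin n) : Module.End ℝ (Finset (Fin n) →₀ ℝ) :=
  Finsupp.linearCombination ℝ fun A => Finsupp.single (A ∆ {i}) (repSign i A)

theorem repGen_single {n : ℕ} (i : Fin n) (A : Finset (Fin n)) (c : ℝ) :
    repGen i (Finsupp.single A c) = Finsupp.single (A ∆ {i}) (c * repSign i A) := by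
  simp [repGen]

theorem repSign_sq {n : ℕ} (i : Fin n) (A : Finset (Fin n)) : repSign i A * repSign i A = 1 := by
  rw [repSign, ← Finset.prod_mul_distrib]
  exact Finset.prod_eq_one fun j _ => by split_ifs <;> simp

theorem repSign_symmDiff {n : ℕ} (i j : Fin n) (A : Finset (Fin n)) :
    repSign i (A ∆ {j}) = (if j ≤ i then -1 else 1) * repSign i A := by
  by_cases hj : j ∈ A
  · have h : A ∆ {j} = A.erase j := by
      ext x; simp only [Finset.mem_symmDiff, Finset.mem_singleton, Finset.mem_erase]; grind
    rw [h, repSign, repSign, ← Finset.mul_prod_erase A _ hj, ← mul_assoc]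
    split_ifs <;> simp
  · have h : A ∆ {j} = insert j A := by
      ext x; simp only [Finset.mem_symmDiff, Finset.mem_singleton, Finset.mem_insert]; grind
    rw [h, repSign, repSign, Finset.prod_insert hj]

theorem repGen_anticomm {n : ℕ} (i j : Fin n) :
    repGen i * repGen j + repGen j * repGen i = if i = j then (-2 : ℝ) • 1 else 0 := by
  refine Finsupp.lhom_ext fun A c => ?_
  have h : A ∆ {i} ∆ {j} = A ∆ {j} ∆ {i} := symmDiff_right_comm _ _ _
  simp only [LinearMap.add_apply, Module.End.mul_apply, repGen_single, repSign_symmDiff, h,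
    ← Finsupp.single_add]
  by_cases hij : i = j
  · subst hij
    have h2 : A ∆ {i} ∆ {i} = A := symmDiff_symmDiff_cancel_right _ _
    have h3 := repSign_sq i A
    rw [h2]
    simp only [le_refl, if_true, LinearMap.smul_apply, Module.End.one_apply, Finsupp.smul_single]
    congr 1
    simp only [smul_eq_mul]
    linear_combination (-2 * c) * h3
  · rw [if_neg hij]
    rcases lt_or_gt_of_ne hij with h' | h'
    · simp only [h'.le, not_le.2 h', if_true, if_false, LinearMap.zero_apply]
      rw [Finsupp.single_eq_zero]; ring
    · simp only [h'.le, not_le.2 h', if_true, if_false, LinearMap.zero_apply]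
      rw [Finsupp.single_eq_zero]; ring

/-- The left regular representation of `ℝ_n` in the coordinates given by the `e_A`. -/
def rep (n : ℕ) : Cl n →ₐ[ℝ] Module.End ℝ (Finset (Fin n) →₀ ℝ) :=
  CliffordAlgebra.lift (cliffordForm n)
    ⟨∑ i, (LinearMap.proj i : (Fin n → ℝ) →ₗ[ℝ] ℝ).smulRight (repGen i), by
      intro v
      simp only [LinearMap.sum_apply, LinearMap.smulRight_apply, LinearMap.proj_apply]
      have h1 : (∑ i, v i • repGen i) * (∑ i, v i • repGen i) =
          ∑ i, ∑ j, (v i * v j) • (repGen i * repGen j) := by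
        simp only [Finset.sum_mul_sum, smul_mul_smul_comm]
      have h2 : (∑ i, v i • repGen i) * (∑ i, v i • repGen i) =
          ∑ i, ∑ j, (v i * v j) • (repGen j * repGen i) := by
        rw [h1, Finset.sum_comm]
        simp only [mul_comm]
      have h3 : (2 : ℝ) • ((∑ i, v i • repGen i) * (∑ i, v i • repGen i)) =
          (2 : ℝ) • algebraMap ℝ (Module.End ℝ (Finset (Fin n) →₀ ℝ)) (cliffordForm n v) := by
        rw [two_smul]
        nth_rewrite 1 [h1]
        rw [h2, cliffordForm_apply]
        simp only [← Finset.sum_add_distrib, ← smul_add, repGen_anticomm]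
        simp only [smul_ite, smul_zero, Finset.sum_ite_eq, Finset.mem_univ, if_true, smul_smul,
          ← Finset.sum_smul, Algebra.algebraMap_eq_smul_one]
        congr 1
        simp [Finset.mul_sum, ← Finset.sum_neg_distrib, mul_comm]
      exact smul_right_injective _ (two_ne_zero (α := ℝ)) h3⟩

theorem rep_e {n : ℕ} (i : Fin n) : rep n (e i) = repGen i := by
  rw [rep, e, CliffordAlgebra.lift_ι_apply]
  simp [LinearMap.sum_apply, Pi.single_apply]

theorem rep_eProd {n : ℕ} (A : Finset (Fin n)) :
    rep n (eProd A) (Finsupp.single ∅ 1) = Finsupp.single A 1 := by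
  induction A using Finset.induction_on_min with
  | empty => simp [eProd_empty]
  | insert a s has ih =>
    have h2 : s ∆ {a} = insert a s := by
      ext x; simp only [Finset.mem_symmDiff, Finset.mem_insert, Finset.mem_singleton]
      grind
    have h3 : repSign a s = 1 := Finset.prod_eq_one fun j hj => by simp [has j hj]
    rw [eProd_insert has, map_mul, Module.End.mul_apply, ih, rep_e, repGen_single, h2, h3, one_mul]

theorem eProd_linearIndependent {n : ℕ} : LinearIndependent ℝ (eProd (n := n)) := by
  have h : LinearIndependent ℝ
      (((LinearMap.applyₗ (Finsupp.single ∅ 1)).comp (rep n).toLinearMap) ∘ eProd (n := n)) := by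
    have : (((LinearMap.applyₗ (Finsupp.single ∅ 1)).comp (rep n).toLinearMap) ∘ eProd (n := n)) =
        fun A => Finsupp.single A (1 : ℝ) := by
      funext A
      exact rep_eProd A
    rw [this]
    exact Finsupp.linearIndependent_single_one ℝ _
  exact h.of_comp _

/-- The basis `(e_A)_A` of `ℝ_n`, indexed by the subsets `A` of the index set: every Clifford number
is uniquely `a = ∑_A a_A e_A`. -/
def clBasis (n : ℕ) : Module.Basis (Finset (Fin n)) ℝ (Cl n) :=
  Module.Basis.mk eProd_linearIndependent eProd_span

/-- The coordinates `(a_A)_A` of a Clifford number, as a point of Euclidean space `ℝ^{2^n}`. -/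
def clCoords (n : ℕ) : Cl n ≃ₗ[ℝ] EuclideanSpace ℝ (Finset (Fin n)) :=
  (clBasis n).equivFun.trans (WithLp.linearEquiv 2 ℝ (Finset (Fin n) → ℝ)).symm

/-- The Euclidean norm `|a|² = ∑_A |a_A|²` on `ℝ_n`. -/
instance clNormedAddCommGroup (n : ℕ) : NormedAddCommGroup (Cl n) :=
  NormedAddCommGroup.induced (Cl n) (EuclideanSpace ℝ (Finset (Fin n))) (clCoords n)
    (clCoords n).injective

instance clNormedSpace (n : ℕ) : NormedSpace ℝ (Cl n) :=
  NormedSpace.induced ℝ (Cl n) (EuclideanSpace ℝ (Finset (Fin n))) (clCoords n)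

theorem clBasis_apply {n : ℕ} (A : Finset (Fin n)) : clBasis n A = eProd A := by
  simp [clBasis]

theorem cl_norm_sq {n : ℕ} (a : Cl n) : ‖a‖ ^ 2 = ∑ A, (clBasis n).repr a A ^ 2 := by
  change ‖clCoords n a‖ ^ 2 = _
  rw [EuclideanSpace.norm_sq_eq]
  simp [clCoords]

/-! ### Paravectors -/

/-- The space `ℝ^{n+1}` of points `(x₀, x₁, …, x_n)`, with its Euclidean norm. -/
abbrev Pv (n : ℕ) : Type := EuclideanSpace ℝ (Fin (n + 1))

/-- The paravector `x₀ + ∑_l x_l e_l` in `ℝ_n` with which a point of `ℝ^{n+1}` is identified. -/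
def toCl {n : ℕ} (x : Pv n) : Cl n := algebraMap ℝ (Cl n) (x 0) + ∑ l : Fin n, x l.succ • e l

/-- The real unit `1 = (1, 0, …, 0)` of `ℝ^{n+1}`. -/
def e0 (n : ℕ) : Pv n := EuclideanSpace.single 0 1

/-- The sphere `𝕊` of vectors `x₁ e₁ + ⋯ + x_n e_n` with `x₁² + ⋯ + x_n² = 1`. -/
def sphereS (n : ℕ) : Set (Pv n) := {x | x 0 = 0 ∧ ∑ l : Fin n, x l.succ ^ 2 = 1}

/-! ### Entire slice monogenic functions -/

/-- The components `f₀`, `f₁` are even, resp. odd in `v`, are (real) differentiable, and satisfy the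
Cauchy-Riemann equations `∂_u f₀ - ∂_v f₁ = 0`, `∂_v f₀ + ∂_u f₁ = 0` on `ℝ²`. -/
structure IsHolomorphicStem {n : ℕ} (f₀ f₁ : ℝ × ℝ → Cl n) : Prop where
  even : ∀ u v : ℝ, f₀ (u, -v) = f₀ (u, v)
  odd : ∀ u v : ℝ, f₁ (u, -v) = -f₁ (u, v)
  differentiable₀ : Differentiable ℝ f₀
  differentiable₁ : Differentiable ℝ f₁
  cauchyRiemann₁ : ∀ z : ℝ × ℝ, fderiv ℝ f₀ z (1, 0) - fderiv ℝ f₁ z (0, 1) = 0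
  cauchyRiemann₂ : ∀ z : ℝ × ℝ, fderiv ℝ f₀ z (0, 1) + fderiv ℝ f₁ z (1, 0) = 0

/-- Entire left slice monogenic functions: `f(u + j v) = f₀(u, v) + j f₁(u, v)` for `j ∈ 𝕊`. -/
def IsSliceMonogenicL {n : ℕ} (f : Pv n → Cl n) : Prop :=
  ∃ f₀ f₁ : ℝ × ℝ → Cl n, IsHolomorphicStem f₀ f₁ ∧
    ∀ u v : ℝ, ∀ j ∈ sphereS n, f (u • e0 n + v • j) = f₀ (u, v) + toCl j * f₁ (u, v)

/-- Entire right slice monogenic functions: `f(u + j v) = f₀(u, v) + f₁(u, v) j` for `j ∈ 𝕊`. -/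
def IsSliceMonogenicR {n : ℕ} (f : Pv n → Cl n) : Prop :=
  ∃ f₀ f₁ : ℝ × ℝ → Cl n, IsHolomorphicStem f₀ f₁ ∧
    ∀ u v : ℝ, ∀ j ∈ sphereS n, f (u • e0 n + v • j) = f₀ (u, v) + f₁ (u, v) * toCl j

/-! ### The spaces `SM^p` and their convergence -/

/-- There are `B, C > 0` with `|f(x)| ≤ C exp(B |x|^p)` for all `x`. -/
def HasExpGrowth {n : ℕ} (p : ℝ) (f : Pv n → Cl n) : Prop :=
  ∃ B > 0, ∃ C > 0, ∀ x, ‖f x‖ ≤ C * Real.exp (B * ‖x‖ ^ p)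

/-- The space `SM^p_L`. -/
def SML (n : ℕ) (p : ℝ) : Set (Pv n → Cl n) := {f | IsSliceMonogenicL f ∧ HasExpGrowth p f}

/-- The space `SM^p_R`. -/
def SMR (n : ℕ) (p : ℝ) : Set (Pv n → Cl n) := {f | IsSliceMonogenicR f ∧ HasExpGrowth p f}

/-- Convergence `F_k → g` in `SM^p`: for some `B > 0`, the supremum over `x` of
`|(F_k(x) - g(x)) exp(-B |x|^p)|`, taken in `[0, ∞]`, tends to `0` as `k → ∞`. -/
def TendstoSM {n : ℕ} (p : ℝ) (F : ℕ → Pv n → Cl n) (g : Pv n → Cl n) : Prop :=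
  ∃ B > 0, Tendsto (fun k => ⨆ x, ‖Real.exp (-(B * ‖x‖ ^ p)) • (F k x - g x)‖ₑ) atTop (𝓝 0)

/-! ### Derivatives, Taylor coefficients and star products -/

/-- The derivative `∂_{x₀} f`. -/
def partialX0 {n : ℕ} (f : Pv n → Cl n) : Pv n → Cl n := fun x => lineDeriv ℝ f x (e0 n)

/-- The Taylor coefficient `(1/k!) ∂_{x₀}^k f(0)`. An entire left (right) slice monogenic function `f`
is the sum of the power series `∑_k x^k a_k` (`∑_k a_k x^k`) for exactly these `a_k`. -/
def taylorCoeff {n : ℕ} (f : Pv n → Cl n) (k : ℕ) : Cl n :=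
  ((k.factorial : ℝ)⁻¹) • (partialX0^[k] f) 0

/-- The coefficient `∑_{k=0}^l a_k b_{l-k}`, where `a`, `b` are the Taylor coefficients of `f`, `g`. -/
def starCoeff {n : ℕ} (f g : Pv n → Cl n) (l : ℕ) : Cl n :=
  ∑ k ∈ Finset.range (l + 1), taylorCoeff f k * taylorCoeff g (l - k)

/-- The left star product `(f ⋆_L g)(x) = ∑_l x^l (∑_{k=0}^l a_k b_{l-k})`. -/
def starProdL {n : ℕ} (f g : Pv n → Cl n) (x : Pv n) : Cl n := ∑' l, toCl x ^ l * starCoeff f g l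

/-- The right star product `(f ⋆_R g)(x) = ∑_l (∑_{k=0}^l a_k b_{l-k}) x^l`. -/
def starProdR {n : ℕ} (f g : Pv n → Cl n) (x : Pv n) : Cl n := ∑' l, starCoeff f g l * toCl x ^ l

/-! ### Infinite order differential operators -/

/-- There is `B > 0` such that for every `ε > 0` there is `C > 0` with
`|u_m(x)| ≤ C ε^m (m!)^{-1/q} exp(B |x|^p)` for all `m` and `x`, where `1/q = 1 - 1/p`. -/
def CoeffGrowth {n : ℕ} (p : ℝ) (u : ℕ → Pv n → Cl n) : Prop :=
  ∃ B > 0, ∀ ε > 0, ∃ C > 0, ∀ (m : ℕ) (x : Pv n),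
    ‖u m x‖ ≤ C * (ε ^ m / (m.factorial : ℝ) ^ (1 - 1 / p)) * Real.exp (B * ‖x‖ ^ p)

/-- The coefficient sequences of the operators in `D^L_{p,0}`. -/
def DL (n : ℕ) (p : ℝ) : Set (ℕ → Pv n → Cl n) :=
  {u | (∀ m, IsSliceMonogenicL (u m)) ∧ CoeffGrowth p u}

/-- The coefficient sequences of the operators in `D^R_{p,0}`. -/
def DR (n : ℕ) (p : ℝ) : Set (ℕ → Pv n → Cl n) :=
  {u | (∀ m, IsSliceMonogenicR (u m)) ∧ CoeffGrowth p u}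

/-- `U_L(x, ∂_{x₀}) f = ∑_m u_m ⋆_L ∂_{x₀}^m f`, pointwise. -/
def opL {n : ℕ} (u : ℕ → Pv n → Cl n) (f : Pv n → Cl n) (x : Pv n) : Cl n :=
  ∑' m, starProdL (u m) (partialX0^[m] f) x

/-- `U_R(x, ∂_{x₀}) f = ∑_m u_m ⋆_R ∂_{x₀}^m f`, pointwise. -/
def opR {n : ℕ} (u : ℕ → Pv n → Cl n) (f : Pv n → Cl n) (x : Pv n) : Cl n :=
  ∑' m, starProdR (u m) (partialX0^[m] f) x

end

end SliceMonogenic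

open SliceMonogenic

namespace SliceMonogenic

noncomputable section

/-! ### Complex coordinates -/

/-! Growth of order `p` is read off from the Taylor coefficients. If `‖f x‖ ≤ C exp(B‖x‖^p)`,
Cauchy's estimates on a sphere of radius `(k+1)^(1/p)` give `‖a_k‖ ≤ A E^k / (k!)^(1/p)` with `E =
exp B` and `A` proportional to `C` (`exists_norm_taylorCoeff_le_of_exp`). Conversely, a series with
such coefficients is dominated by a Mittag-Leffler type series `∑ t^k / (k!)^(1/p)` with `t`
proportional to `‖x‖`, which is at most `2 exp((2t)^p / p)`.

Applying `∂_{x₀}^m` multiplies the shifted coefficients by `(k+m)!/k!`, which costs `(2E)^m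
(m!)^(1-1/p)` beyond the same type of decay in `k` (`factorial_div_mul_le`). The bound on `u_m`
contains exactly the inverse factorial power, and `ε = 1/(4E)` leaves `2^(-m)`. Convolution
preserves the decay in the degree, so the star coefficients satisfy `‖c_{m,l}‖ ≤ K 2^(-m) G^l /
(l!)^(1/p)` (`exists_norm_starCoeff_le`). The double series is then absolutely convergent, may be
rearranged into one power series, and has growth of order `p`. All constants depend on `f` only
through `B`, and linearly on `C`; applied to `F k - g`, this is continuity.

The Cauchy estimates come from the complex stem `f₀ + i f₁`, an entire function with values in
`ℂ^(2^n)`. The left and right cases are treated together: only the action `M` of paravectors on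
`ℝ_n` differs, and the argument uses only that `1` acts as the identity and each `j ∈ 𝕊` as a square
root of `-1`. -/

instance clFiniteDimensional (n : ℕ) : FiniteDimensional ℝ (Cl n) :=
  (clBasis n).finiteDimensional_of_finite

/-- The coordinates of a Clifford number, as complex numbers. -/
def complexify (n : ℕ) : Cl n →L[ℝ] (Finset (Fin n) → ℂ) :=
  LinearMap.toContinuousLinearMap
    (LinearMap.pi fun A => Complex.ofRealCLM.toLinearMap ∘ₗ (clBasis n).coord A)

/-- The Clifford number whose coordinates are the real parts of the given complex numbers. -/
def realPart (n : ℕ) : (Finset (Fin n) → ℂ) →L[ℝ] Cl n :=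
  LinearMap.toContinuousLinearMap
    (∑ A, (Complex.reCLM.toLinearMap ∘ₗ
      (LinearMap.proj A : (Finset (Fin n) → ℂ) →ₗ[ℝ] ℂ)).smulRight (clBasis n A))

/-- The coordinates of `complexify n a` are real, so only `z.re` survives. Replacing `z` by `-i z`
extracts `z.im` instead. -/
theorem realPart_smul_complexify {n : ℕ} (z : ℂ) (a : Cl n) :
    realPart n (z • complexify n a) = z.re • a := by
  have h := (clBasis n).sum_repr a
  conv_rhs => rw [← h, Finset.smul_sum]
  simp [realPart, complexify, smul_smul]

theorem realPart_complexify {n : ℕ} (a : Cl n) : realPart n (complexify n a) = a := by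
  simpa using realPart_smul_complexify 1 a

/-- The complex function `f₀ + i f₁` attached to a pair of components. -/
def stemFun {n : ℕ} (f₀ f₁ : ℝ × ℝ → Cl n) (z : ℂ) : Finset (Fin n) → ℂ :=
  complexify n (f₀ (z.re, z.im)) + Complex.I • complexify n (f₁ (z.re, z.im))

/-- The Cauchy-Riemann equations say that the real derivative in direction `i` is `i` times the one
in direction `1`. -/
theorem IsHolomorphicStem.differentiable_stemFun {n : ℕ} {f₀ f₁ : ℝ × ℝ → Cl n}
    (h : IsHolomorphicStem f₀ f₁) : Differentiable ℂ (stemFun f₀ f₁) := by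
  intro z
  have hp := Complex.equivRealProdCLM.toContinuousLinearMap.hasFDerivAt (x := z)
  have h0 := (complexify n).hasFDerivAt.comp z
    (((h.differentiable₀ (z.re, z.im)).hasFDerivAt).comp z hp)
  have h1 := (complexify n).hasFDerivAt.comp z
    (((h.differentiable₁ (z.re, z.im)).hasFDerivAt).comp z hp)
  have h2 := h0.add (h1.const_smul Complex.I)
  have h3 : HasFDerivAt (stemFun f₀ f₁) _ z := h2
  rw [differentiableAt_complex_iff_differentiableAt_real]
  refine ⟨h3.differentiableAt, ?_⟩
  rw [h3.fderiv]
  have e1 : fderiv ℝ f₀ (z.re, z.im) (1, 0) = fderiv ℝ f₁ (z.re, z.im) (0, 1) :=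
    sub_eq_zero.1 (h.cauchyRiemann₁ _)
  have e2 : fderiv ℝ f₀ (z.re, z.im) (0, 1) = -fderiv ℝ f₁ (z.re, z.im) (1, 0) :=
    eq_neg_of_add_eq_zero_left (h.cauchyRiemann₂ _)
  simp [e1, e2, smul_smul, smul_add, add_comm]

/-- Carries Cauchy's estimates for complex derivatives over to real ones. `L` is only real linear,
which suffices along the real axis. -/
theorem iteratedDeriv_clm_comp_ofReal {F V : Type*} [NormedAddCommGroup F] [NormedSpace ℂ F]
    [CompleteSpace F] [NormedAddCommGroup V] [NormedSpace ℝ V] (L : F →L[ℝ] V) {G : ℂ → F}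
    (hG : Differentiable ℂ G) (k : ℕ) :
    iteratedDeriv k (fun t : ℝ => L (G t)) = fun t : ℝ => L (iteratedDeriv k G t) := by
  induction k with
  | zero => simp
  | succ k ih =>
    funext t
    rw [iteratedDeriv_succ, ih, iteratedDeriv_succ]
    have hd : HasDerivAt (iteratedDeriv k G) (deriv (iteratedDeriv k G) t) (t : ℂ) :=
      ((hG.contDiff (n := ⊤)).differentiable_iteratedDeriv k (by simp) _).hasDerivAt
    have h1 := hd.scomp t (Complex.ofRealCLM.hasDerivAt (x := t))
    have h2 := (L.hasFDerivAt.comp_hasDerivAt t h1).deriv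
    simp only [Complex.ofRealCLM_apply, Complex.ofReal_one, one_smul] at h2
    exact h2

/-! ### Taylor coefficients -/

/-- The real axis is invariant under translation along `e0`, so the Taylor coefficients see only the
restriction of `f` to it. No regularity of `f` is needed. -/
theorem partialX0_iterate_smul_e0 {n : ℕ} (f : Pv n → Cl n) (k : ℕ) (t : ℝ) :
    (partialX0^[k] f) (t • e0 n) = iteratedDeriv k (fun s : ℝ => f (s • e0 n)) t := by
  induction k generalizing t with
  | zero => simp
  | succ k ih =>
    rw [Function.iterate_succ_apply', iteratedDeriv_succ, partialX0, lineDeriv]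
    simp_rw [← add_smul, ih]
    simpa using deriv_comp_const_add (f := iteratedDeriv k (fun s : ℝ => f (s • e0 n))) t 0

theorem taylorCoeff_eq_iteratedDeriv {n : ℕ} (f : Pv n → Cl n) (k : ℕ) :
    taylorCoeff f k =
      ((k.factorial : ℝ)⁻¹) • iteratedDeriv k (fun s : ℝ => f (s • e0 n)) 0 := by
  rw [taylorCoeff, ← partialX0_iterate_smul_e0, zero_smul]

theorem taylorCoeff_partialX0_iterate {n : ℕ} (f : Pv n → Cl n) (m k : ℕ) :
    taylorCoeff (partialX0^[m] f) k =
      (((k + m).factorial : ℝ) / k.factorial) • taylorCoeff f (k + m) := by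
  have h : ((k + m).factorial : ℝ) ≠ 0 := by positivity
  rw [taylorCoeff, taylorCoeff, ← Function.iterate_add_apply, smul_smul]
  congr 1
  field_simp

/-! ### Slice functions for a multiplication by paravectors -/

/-- Left or right multiplication by paravectors, seen as operators on `ℝ_n`: it is unital, and
elements of the sphere act as imaginary units. -/
structure IsParavectorAction {n : ℕ} (M : Pv n →L[ℝ] Cl n →L[ℝ] Cl n) : Prop where
  unit : ∀ a, M (e0 n) a = a
  sphere : ∀ j ∈ sphereS n, ∀ a, M j (M j a) = -a

/-- Entire slice monogenic functions with respect to the action `M`. -/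
def IsSliceMonogenic {n : ℕ} (M : Pv n →L[ℝ] Cl n →L[ℝ] Cl n) (f : Pv n → Cl n) : Prop :=
  ∃ f₀ f₁ : ℝ × ℝ → Cl n, IsHolomorphicStem f₀ f₁ ∧
    ∀ u v : ℝ, ∀ j ∈ sphereS n, f (u • e0 n + v • j) = f₀ (u, v) + M j (f₁ (u, v))

theorem toCl_e0 {n : ℕ} : toCl (e0 n) = 1 := by
  simp [toCl, e0]

theorem toCl_mul_self_of_mem_sphereS {n : ℕ} {j : Pv n} (hj : j ∈ sphereS n) :
    toCl j * toCl j = -1 := by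
  have h : toCl j = CliffordAlgebra.ι (cliffordForm n) (fun l => j l.succ) := by
    rw [ι_eq_sum, toCl, hj.1, map_zero, zero_add]
  rw [h, CliffordAlgebra.ι_sq_scalar, cliffordForm_apply]
  have h2 := hj.2
  simp only [pow_two] at h2
  simp [h2]

/-- The embedding of paravectors into `ℝ_n`, as a linear map. -/
def toClLinear (n : ℕ) : Pv n →ₗ[ℝ] Cl n where
  toFun := toCl
  map_add' x y := by
    simp only [toCl, PiLp.add_apply, map_add, add_smul, Finset.sum_add_distrib]
    abel
  map_smul' c x := by
    simp only [toCl, PiLp.smul_apply, smul_eq_mul, map_mul, Algebra.smul_def, RingHom.id_apply,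
      mul_add, Finset.mul_sum, mul_assoc]

/-- Left multiplication by paravectors. -/
def leftAction (n : ℕ) : Pv n →L[ℝ] Cl n →L[ℝ] Cl n :=
  ((LinearMap.mul ℝ (Cl n)) ∘ₗ toClLinear n).toContinuousBilinearMap

/-- Right multiplication by paravectors. -/
def rightAction (n : ℕ) : Pv n →L[ℝ] Cl n →L[ℝ] Cl n :=
  ((LinearMap.mul ℝ (Cl n)).flip ∘ₗ toClLinear n).toContinuousBilinearMap

theorem leftAction_apply {n : ℕ} (x : Pv n) (a : Cl n) : leftAction n x a = toCl x * a := rfl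

theorem rightAction_apply {n : ℕ} (x : Pv n) (a : Cl n) : rightAction n x a = a * toCl x := rfl

theorem leftAction_pow_apply {n : ℕ} (x : Pv n) (l : ℕ) (a : Cl n) :
    (leftAction n x ^ l) a = toCl x ^ l * a := by
  induction l with
  | zero => simp
  | succ l ih => rw [pow_succ', mul_apply_eq_comp, ih, leftAction_apply, pow_succ',
      mul_assoc]

theorem rightAction_pow_apply {n : ℕ} (x : Pv n) (l : ℕ) (a : Cl n) :
    (rightAction n x ^ l) a = a * toCl x ^ l := by
  induction l with
  | zero => simp
  | succ l ih => rw [pow_succ', mul_apply_eq_comp, ih, rightAction_apply, pow_succ,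
      mul_assoc]

theorem isParavectorAction_leftAction (n : ℕ) : IsParavectorAction (leftAction n) where
  unit a := by rw [leftAction_apply, toCl_e0, one_mul]
  sphere j hj a := by
    rw [leftAction_apply, leftAction_apply, ← mul_assoc, toCl_mul_self_of_mem_sphereS hj,
      neg_one_mul]

theorem isParavectorAction_rightAction (n : ℕ) : IsParavectorAction (rightAction n) where
  unit a := by rw [rightAction_apply, toCl_e0, mul_one]
  sphere j hj a := by
    rw [rightAction_apply, rightAction_apply, mul_assoc, toCl_mul_self_of_mem_sphereS hj,
      mul_neg_one]

theorem sphereS_nonempty {n : ℕ} (hn : 1 ≤ n) : (sphereS n).Nonempty := by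
  obtain ⟨m, rfl⟩ := Nat.exists_eq_add_of_le' hn
  refine ⟨EuclideanSpace.single (Fin.succ 0) 1, by simp, ?_⟩
  rw [Finset.sum_eq_single 0]
  · simp
  · intro b _ hb
    have h : b.succ ≠ Fin.succ 0 := fun h => hb (Fin.succ_injective _ h)
    rw [PiLp.single_apply, if_neg h, sq, mul_zero]
  · simp

theorem norm_smul_e0_add_smul_sq {n : ℕ} {j : Pv n} (hj : j ∈ sphereS n) (u v : ℝ) :
    ‖u • e0 n + v • j‖ ^ 2 = u ^ 2 + v ^ 2 := by
  have h2 := hj.2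
  rw [EuclideanSpace.norm_sq_eq, Fin.sum_univ_succ]
  simp [e0, hj.1, mul_pow, ← Finset.mul_sum, h2]

/-! ### Differences of slice monogenic functions and Cauchy's estimates -/

theorem IsHolomorphicStem.sub {n : ℕ} {f₀ f₁ g₀ g₁ : ℝ × ℝ → Cl n} (hf : IsHolomorphicStem f₀ f₁)
    (hg : IsHolomorphicStem g₀ g₁) : IsHolomorphicStem (f₀ - g₀) (f₁ - g₁) where
  even u v := by simp [hf.even, hg.even]
  odd u v := by simp [hf.odd, hg.odd]; abel
  differentiable₀ := hf.differentiable₀.sub hg.differentiable₀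
  differentiable₁ := hf.differentiable₁.sub hg.differentiable₁
  cauchyRiemann₁ z := by
    have h1 := hf.cauchyRiemann₁ z
    have h2 := hg.cauchyRiemann₁ z
    rw [fderiv_sub (hf.differentiable₀ z) (hg.differentiable₀ z),
      fderiv_sub (hf.differentiable₁ z) (hg.differentiable₁ z)]
    rw [sub_eq_zero] at h1 h2
    simp [h1, h2]
  cauchyRiemann₂ z := by
    have h1 := hf.cauchyRiemann₂ z
    have h2 := hg.cauchyRiemann₂ z
    rw [fderiv_sub (hf.differentiable₀ z) (hg.differentiable₀ z),
      fderiv_sub (hf.differentiable₁ z) (hg.differentiable₁ z)]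
    rw [← eq_neg_iff_add_eq_zero] at h1 h2
    simp [h1, h2]

theorem IsSliceMonogenic.sub {n : ℕ} {M : Pv n →L[ℝ] Cl n →L[ℝ] Cl n} {f g : Pv n → Cl n}
    (hf : IsSliceMonogenic M f) (hg : IsSliceMonogenic M g) : IsSliceMonogenic M (f - g) := by
  obtain ⟨f₀, f₁, hs, hf⟩ := hf
  obtain ⟨g₀, g₁, ht, hg⟩ := hg
  refine ⟨f₀ - g₀, f₁ - g₁, hs.sub ht, fun u v j hj => ?_⟩
  simp only [Pi.sub_apply, hf u v j hj, hg u v j hj, map_sub]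
  abel

theorem IsSliceMonogenic.zero {n : ℕ} (M : Pv n →L[ℝ] Cl n →L[ℝ] Cl n) :
    IsSliceMonogenic M (0 : Pv n → Cl n) :=
  ⟨0, 0, ⟨by simp, by simp, by fun_prop, by fun_prop, by simp, by simp⟩, by simp⟩

/-- Oddness forces `f₁ (t, 0) = 0`, so on the real axis both sides are `f₀ (t, 0)`. The condition `1
≤ n` provides a point of the sphere, without which the representation of `f` would be vacuous. -/
theorem eq_realPart_stemFun {n : ℕ} (hn : 1 ≤ n) {M : Pv n →L[ℝ] Cl n →L[ℝ] Cl n}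
    {f : Pv n → Cl n} {f₀ f₁ : ℝ × ℝ → Cl n}
    (hf : ∀ u v : ℝ, ∀ j ∈ sphereS n, f (u • e0 n + v • j) = f₀ (u, v) + M j (f₁ (u, v)))
    (hs : IsHolomorphicStem f₀ f₁) :
    (fun t : ℝ => f (t • e0 n)) = fun t : ℝ => realPart n (stemFun f₀ f₁ t) := by
  funext t
  obtain ⟨j, hj⟩ := sphereS_nonempty hn
  have h0 : f₁ (t, 0) = 0 := by
    have h := hs.odd t 0
    rw [neg_zero] at h
    exact (smul_eq_zero.1 ((two_smul ℝ _).trans (eq_neg_iff_add_eq_zero.1 h))).resolve_left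
      two_ne_zero
  have h := hf t 0 j hj
  rw [zero_smul, add_zero, h0, map_zero, add_zero] at h
  simp [h, stemFun, h0, realPart_complexify]

/-- Smoothness is inherited from the entire stem; it is what makes the iterated derivatives, hence
the Taylor coefficients, subtractive. -/
theorem IsSliceMonogenic.contDiff {n : ℕ} (hn : 1 ≤ n) {M : Pv n →L[ℝ] Cl n →L[ℝ] Cl n}
    {f : Pv n → Cl n} (hf : IsSliceMonogenic M f) (k : ℕ) :
    ContDiff ℝ k (fun t : ℝ => f (t • e0 n)) := by
  obtain ⟨f₀, f₁, hs, hf⟩ := hf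
  rw [eq_realPart_stemFun hn hf hs]
  have h := (hs.differentiable_stemFun.contDiff (n := k)).restrict_scalars ℝ
  exact (realPart n).contDiff.comp (h.comp Complex.ofRealCLM.contDiff)

theorem IsSliceMonogenic.taylorCoeff_sub {n : ℕ} (hn : 1 ≤ n)
    {M : Pv n →L[ℝ] Cl n →L[ℝ] Cl n} {f g : Pv n → Cl n}
    (hf : IsSliceMonogenic M f) (hg : IsSliceMonogenic M g) (k : ℕ) :
    taylorCoeff (f - g) k = taylorCoeff f k - taylorCoeff g k := by
  simp only [taylorCoeff_eq_iteratedDeriv, Pi.sub_apply, ← smul_sub]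
  congr 1
  exact iteratedDeriv_fun_sub (hf.contDiff hn k).contDiffAt (hg.contDiff hn k).contDiffAt

theorem taylorCoeff_zero {n : ℕ} (k : ℕ) : taylorCoeff (0 : Pv n → Cl n) k = 0 := by
  rw [taylorCoeff_eq_iteratedDeriv]
  simp

/-- Cauchy's estimates for the Taylor coefficients of slice monogenic functions. -/
theorem exists_norm_taylorCoeff_le {n : ℕ} (hn : 1 ≤ n) {M : Pv n →L[ℝ] Cl n →L[ℝ] Cl n}
    (hM : IsParavectorAction M) :
    ∃ K > 0, ∀ f : Pv n → Cl n, IsSliceMonogenic M f → ∀ R > 0, ∀ C : ℝ,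
      (∀ x, ‖x‖ = R → ‖f x‖ ≤ C) → ∀ k, ‖taylorCoeff f k‖ ≤ K * C / R ^ k := by
  obtain ⟨j, hj⟩ := sphereS_nonempty hn
  set c := ‖complexify n‖
  set d := ‖M j‖
  -- The factor `c + c * d` bounds the stem by the values of `f`, and `‖realPart n‖` is the cost of
  -- returning to `ℝ_n`; the `+ 1` only ensures positivity.
  refine ⟨‖realPart n‖ * (c + c * d) + 1, by positivity, fun f hf R hR C hC k => ?_⟩
  obtain ⟨f₀, f₁, hs, hf⟩ := hf
  have hbound : ∀ z ∈ Metric.sphere (0 : ℂ) R, ‖stemFun f₀ f₁ z‖ ≤ (c + c * d) * C := by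
    intro z hz
    have hz' : z.re ^ 2 + z.im ^ 2 = R ^ 2 := by
      rw [mem_sphere_zero_iff_norm] at hz
      rw [← hz, ← Complex.normSq_eq_norm_sq, Complex.normSq_apply]; ring
    have h1 : ‖f (z.re • e0 n + z.im • j)‖ ≤ C := hC _ <| by
      rw [← sq_eq_sq₀ (norm_nonneg _) hR.le, norm_smul_e0_add_smul_sq hj, hz']
    have h2 : ‖f (z.re • e0 n + (-z.im) • j)‖ ≤ C := hC _ <| by
      rw [← sq_eq_sq₀ (norm_nonneg _) hR.le, norm_smul_e0_add_smul_sq hj, neg_sq, hz']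
    have e1 := hf z.re z.im j hj
    have e2 := hf z.re (-z.im) j hj
    rw [hs.even, hs.odd, map_neg] at e2
    -- By parity, `f₀` and `M j f₁` are the half sum and half difference of the values of `f` at `u
    -- + jv` and `u - jv`, both of norm `R`.
    have b0 : ‖f₀ (z.re, z.im)‖ ≤ C := by
      have : f₀ (z.re, z.im) = (1 / 2 : ℝ) •
          (f (z.re • e0 n + z.im • j) + f (z.re • e0 n + (-z.im) • j)) := by
        rw [e1, e2]; module
      rw [this, norm_smul, Real.norm_of_nonneg (by norm_num)]
      have := norm_add_le (f (z.re • e0 n + z.im • j)) (f (z.re • e0 n + (-z.im) • j))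
      linarith
    have b1 : ‖f₁ (z.re, z.im)‖ ≤ d * C := by
      have e3 : M j (f₁ (z.re, z.im)) = (1 / 2 : ℝ) •
          (f (z.re • e0 n + z.im • j) - f (z.re • e0 n + (-z.im) • j)) := by
        rw [e1, e2]; module
      have b : ‖M j (f₁ (z.re, z.im))‖ ≤ C := by
        rw [e3, norm_smul, Real.norm_of_nonneg (by norm_num)]
        have := norm_sub_le (f (z.re • e0 n + z.im • j)) (f (z.re • e0 n + (-z.im) • j))
        linarith
      -- Since `M j` has inverse `-M j`, a bound on `M j f₁` gives one on `f₁` at the cost of `d =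
      -- ‖M j‖`.
      have e4 := hM.sphere j hj (f₁ (z.re, z.im))
      rw [← norm_neg, ← e4]
      exact ((M j).le_opNorm _).trans (by gcongr)
    calc ‖stemFun f₀ f₁ z‖ ≤ ‖complexify n (f₀ (z.re, z.im))‖ +
          ‖Complex.I • complexify n (f₁ (z.re, z.im))‖ := norm_add_le _ _
      _ ≤ c * C + c * (d * C) := by
          rw [norm_smul, Complex.norm_I, one_mul]
          exact add_le_add (((complexify n).le_opNorm _).trans (by gcongr))
            (((complexify n).le_opNorm _).trans (by gcongr))
      _ = (c + c * d) * C := by ring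
  have hk := Complex.norm_iteratedDeriv_le_of_forall_mem_sphere_norm_le k hR
    hs.differentiable_stemFun.diffContOnCl hbound
  have hC0 : 0 ≤ C := by
    have h : ‖(R • e0 n + (0 : ℝ) • j)‖ = R := by
      rw [← sq_eq_sq₀ (norm_nonneg _) hR.le, norm_smul_e0_add_smul_sq hj]; ring
    exact (norm_nonneg _).trans (hC _ h)
  rw [taylorCoeff_eq_iteratedDeriv, eq_realPart_stemFun hn hf hs,
    iteratedDeriv_clm_comp_ofReal _ hs.differentiable_stemFun, norm_smul, norm_inv,
    Real.norm_natCast]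
  have hkf : (0 : ℝ) < k.factorial := by positivity
  calc (k.factorial : ℝ)⁻¹ * ‖realPart n (iteratedDeriv k (stemFun f₀ f₁) ((0 : ℝ) : ℂ))‖
      ≤ (k.factorial : ℝ)⁻¹ *
          (‖realPart n‖ * (k.factorial * ((c + c * d) * C) / R ^ k)) := by
        gcongr
        refine ((realPart n).le_opNorm _).trans ?_
        gcongr
        simpa using hk
    _ = ‖realPart n‖ * (c + c * d) * C / R ^ k := by field_simp
    _ ≤ (‖realPart n‖ * (c + c * d) + 1) * C / R ^ k := by gcongr; linarith

/-! ### Power series -/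

theorem norm_action_pow_apply_le {n : ℕ} (M : Pv n →L[ℝ] Cl n →L[ℝ] Cl n) (x : Pv n) (l : ℕ)
    (a : Cl n) : ‖(M x ^ l) a‖ ≤ (‖M‖ * ‖x‖) ^ l * ‖a‖ := by
  induction l with
  | zero => simp
  | succ l ih =>
    rw [pow_succ', mul_apply_eq_comp, pow_succ', mul_assoc]
    exact (M.le_opNorm₂ x _).trans (by gcongr)

/-- On the slice through `j`, the operator `M j` plays the role of `i`, so powers are computed as in
`ℂ`. -/
theorem IsParavectorAction.pow_apply {n : ℕ} {M : Pv n →L[ℝ] Cl n →L[ℝ] Cl n}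
    (hM : IsParavectorAction M) {j : Pv n} (hj : j ∈ sphereS n) (z : ℂ) (l : ℕ) (a : Cl n) :
    (M (z.re • e0 n + z.im • j) ^ l) a = (z ^ l).re • a + M j ((z ^ l).im • a) := by
  induction l with
  | zero => simp
  | succ l ih =>
    rw [pow_succ', mul_apply_eq_comp, ih, pow_succ', Complex.mul_re, Complex.mul_im]
    simp only [map_add, map_smul, add_apply, smul_apply,
      hM.unit, hM.sphere j hj]
    module

/-- The complexified power series `∑ z^l c_l`. -/
def complexSeries {n : ℕ} (c : ℕ → Cl n) (z : ℂ) : Finset (Fin n) → ℂ :=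
  ∑' l, z ^ l • complexify n (c l)

theorem summable_complexSeries {n : ℕ} {c : ℕ → Cl n}
    (hc : ∀ r : ℝ, 0 ≤ r → Summable fun l => r ^ l * ‖c l‖) (z : ℂ) :
    Summable fun l => z ^ l • complexify n (c l) := by
  refine Summable.of_norm_bounded ((hc ‖z‖ (norm_nonneg _)).mul_left ‖complexify n‖) fun l => ?_
  rw [norm_smul, norm_pow, mul_left_comm]
  gcongr
  exact (complexify n).le_opNorm _

theorem differentiable_complexSeries {n : ℕ} {c : ℕ → Cl n}
    (hc : ∀ r : ℝ, 0 ≤ r → Summable fun l => r ^ l * ‖c l‖) :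
    Differentiable ℂ (complexSeries c) := by
  intro z
  have hr : 0 ≤ ‖z‖ + 1 := by positivity
  refine (Complex.differentiableOn_tsum_of_summable_norm (U := Metric.ball 0 (‖z‖ + 1))
    ((hc (‖z‖ + 1) hr).mul_left ‖complexify n‖) (fun l => ?_) Metric.isOpen_ball
    fun l w hw => ?_).differentiableAt (Metric.isOpen_ball.mem_nhds (by simp))
  · exact ((differentiable_id.pow l).smul_const _).differentiableOn
  · rw [mem_ball_zero_iff] at hw
    rw [norm_smul, norm_pow, mul_left_comm]
    gcongr
    exact (complexify n).le_opNorm _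

/-- With `G` the entire function `complexSeries c`, the components are `realPart` of `G` and of `-i
G`. The Cauchy-Riemann equations express the complex linearity of the derivative of `G`, and the
parities come from conjugation commuting with powers. -/
theorem isHolomorphicStem_complexSeries {n : ℕ} {c : ℕ → Cl n}
    (hc : ∀ r : ℝ, 0 ≤ r → Summable fun l => r ^ l * ‖c l‖) :
    IsHolomorphicStem (fun p => ∑' l, (Complex.equivRealProdCLM.symm p ^ l).re • c l)
      (fun p => ∑' l, (Complex.equivRealProdCLM.symm p ^ l).im • c l) := by
  set φ := Complex.equivRealProdCLM.symm
  have hd := differentiable_complexSeries hc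
  have e0 : (fun p : ℝ × ℝ => ∑' l, (φ p ^ l).re • c l) =
      fun p => realPart n (complexSeries c (φ p)) := by
    funext p
    rw [complexSeries, (realPart n).map_tsum (summable_complexSeries hc _)]
    simp only [realPart_smul_complexify]
  have e1 : (fun p : ℝ × ℝ => ∑' l, (φ p ^ l).im • c l) =
      fun p => realPart n ((-Complex.I) • complexSeries c (φ p)) := by
    funext p
    rw [complexSeries, ← (summable_complexSeries hc _).tsum_const_smul,
      (realPart n).map_tsum ((summable_complexSeries hc _).const_smul _)]
    simp only [smul_smul, realPart_smul_complexify]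
    simp
  have hG : ∀ p, HasFDerivAt (fun p => complexSeries c (φ p)) _ p := fun p =>
    ((hd (φ p)).hasDerivAt.hasFDerivAt.restrictScalars ℝ).comp p φ.hasFDerivAt
  have h0 : ∀ p, HasFDerivAt (fun p => realPart n (complexSeries c (φ p))) _ p := fun p =>
    (realPart n).hasFDerivAt.comp p (hG p)
  have h1 : ∀ p, HasFDerivAt (fun p => realPart n ((-Complex.I) • complexSeries c (φ p))) _ p :=
    fun p => (realPart n).hasFDerivAt.comp p ((hG p).const_smul (-Complex.I))
  have hu : φ (1, 0) = 1 := by simp [φ, Complex.ext_iff]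
  have hv : φ (0, 1) = Complex.I := by simp [φ, Complex.ext_iff]
  have hconj : ∀ u v : ℝ, φ (u, -v) = (starRingEnd ℂ) (φ (u, v)) := by
    intro u v; simp [φ, Complex.ext_iff]
  constructor
  · intro u v
    simp only [hconj, ← map_pow, Complex.conj_re]
  · intro u v
    simp only [hconj, ← map_pow, Complex.conj_im, neg_smul, tsum_neg]
  · rw [e0]; exact fun p => (h0 p).differentiableAt
  · rw [e1]; exact fun p => (h1 p).differentiableAt
  · intro p
    rw [e0, e1, (h0 p).fderiv, (h1 p).fderiv]
    simp [hu, hv, smul_smul]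
  · intro p
    rw [e0, e1, (h0 p).fderiv, (h1 p).fderiv]
    simp [hu, hv]

theorem isSliceMonogenic_tsum {n : ℕ} {M : Pv n →L[ℝ] Cl n →L[ℝ] Cl n}
    (hM : IsParavectorAction M) {c : ℕ → Cl n}
    (hc : ∀ r : ℝ, 0 ≤ r → Summable fun l => r ^ l * ‖c l‖) :
    IsSliceMonogenic M (fun x => ∑' l, (M x ^ l) (c l)) := by
  refine ⟨_, _, isHolomorphicStem_complexSeries hc, fun u v j hj => ?_⟩
  have hz := fun l => hM.pow_apply hj (⟨u, v⟩ : ℂ) l (c l)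
  have hs := hc ‖(⟨u, v⟩ : ℂ)‖ (norm_nonneg _)
  have s0 : Summable fun l => ((⟨u, v⟩ : ℂ) ^ l).re • c l :=
    Summable.of_norm_bounded hs fun l => by
      rw [norm_smul, ← norm_pow]
      gcongr
      exact Complex.abs_re_le_norm _
  have s1 : Summable fun l => ((⟨u, v⟩ : ℂ) ^ l).im • c l :=
    Summable.of_norm_bounded hs fun l => by
      rw [norm_smul, ← norm_pow]
      gcongr
      exact Complex.abs_im_le_norm _
  have hφ : Complex.equivRealProdCLM.symm (u, v) = ⟨u, v⟩ := by simp [Complex.ext_iff]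
  simp only at hz
  simp only [hz, hφ]
  rw [(s0.tsum_add ((M j).summable s1)), (M j).map_tsum s1]

/-! ### Mittag-Leffler type series -/

/-- Take the power `1/p` of `s^k / k! ≤ exp s` at `s = (2t)^p`. The spare factor `2` yields the
geometric `(1/2)^k`, so that summing over `k` costs only a constant. -/
theorem pow_div_factorial_rpow_le {p t : ℝ} (hp : 1 ≤ p) (ht : 0 ≤ t) (k : ℕ) :
    t ^ k / (k.factorial : ℝ) ^ (1 / p) ≤ (1 / 2) ^ k * Real.exp ((2 * t) ^ p / p) := by
  have hp0 : 0 < p := by linarith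
  have h := Real.pow_div_factorial_le_exp (x := (2 * t) ^ p) (by positivity) k
  have h2 := Real.rpow_le_rpow (by positivity) h (z := 1 / p) (by positivity)
  have e1 : (((2 * t) ^ p) ^ k) ^ (1 / p) = (2 * t) ^ k := by
    rw [← Real.rpow_natCast, ← Real.rpow_mul (by positivity), ← Real.rpow_mul (by positivity),
      ← Real.rpow_natCast (2 * t)]
    congr 1
    field_simp
  rw [Real.div_rpow (by positivity) (by positivity), e1, ← Real.exp_mul, mul_one_div,
    mul_pow] at h2
  calc t ^ k / (k.factorial : ℝ) ^ (1 / p)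
      = (1 / 2) ^ k * (2 ^ k * t ^ k / (k.factorial : ℝ) ^ (1 / p)) := by
        rw [one_div_pow]; field_simp
    _ ≤ _ := by gcongr

theorem summable_pow_div_factorial_rpow {p t : ℝ} (hp : 1 ≤ p) (ht : 0 ≤ t) :
    Summable fun k : ℕ => t ^ k / (k.factorial : ℝ) ^ (1 / p) :=
  Summable.of_nonneg_of_le (fun k => by positivity) (pow_div_factorial_rpow_le hp ht)
    (summable_geometric_two.mul_right _)

theorem tsum_pow_div_factorial_rpow_le {p t : ℝ} (hp : 1 ≤ p) (ht : 0 ≤ t) :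
    ∑' k : ℕ, t ^ k / (k.factorial : ℝ) ^ (1 / p) ≤ 2 * Real.exp ((2 * t) ^ p / p) := by
  refine ((summable_pow_div_factorial_rpow hp ht).tsum_le_tsum (pow_div_factorial_rpow_le hp ht)
    (summable_geometric_two.mul_right _)).trans ?_
  rw [tsum_mul_right, tsum_geometric_two]

/-- Taylor coefficients of slice monogenic functions of exponential growth. -/
theorem exists_norm_taylorCoeff_le_of_exp {n : ℕ} (hn : 1 ≤ n)
    {M : Pv n →L[ℝ] Cl n →L[ℝ] Cl n} (hM : IsParavectorAction M) {p : ℝ} (hp : 1 ≤ p) :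
    ∃ K > 0, ∀ f : Pv n → Cl n, IsSliceMonogenic M f → ∀ B C : ℝ, 0 ≤ C →
      (∀ x, ‖f x‖ ≤ C * Real.exp (B * ‖x‖ ^ p)) →
      ∀ k, ‖taylorCoeff f k‖ ≤
        K * Real.exp B * C * (Real.exp B ^ k / (k.factorial : ℝ) ^ (1 / p)) := by
  obtain ⟨K, hK, h⟩ := exists_norm_taylorCoeff_le hn hM
  refine ⟨K, hK, fun f hf B C hC0 hC k => ?_⟩
  have hp0 : 0 < p := by linarith
  -- With this radius the exponential `exp(B R^p)` is geometric in `k`, while `R^k` dominates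
  -- `(k!)^(1/p)`. Using `k + 1` keeps `R` positive at `k = 0`.
  set R : ℝ := ((k : ℝ) + 1) ^ (1 / p)
  have hR : 0 < R := by positivity
  have hRp : R ^ p = k + 1 := by
    rw [← Real.rpow_mul (by positivity), one_div_mul_cancel hp0.ne', Real.rpow_one]
  have h1 := h f hf R hR (C * Real.exp (B * (k + 1))) (fun x hx => by
    have := hC x
    rwa [hx, hRp] at this) k
  refine h1.trans ?_
  have e1 : Real.exp (B * (k + 1)) = Real.exp B ^ k * Real.exp B := by
    rw [← Real.exp_nat_mul, ← Real.exp_add]; ring_nf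
  have hfac : (k.factorial : ℝ) ^ (1 / p) ≤ R ^ k := by
    have : R ^ k = (((k : ℝ) + 1) ^ k) ^ (1 / p) := by
      rw [← Real.rpow_natCast, ← Real.rpow_natCast, ← Real.rpow_mul (by positivity),
        ← Real.rpow_mul (by positivity), mul_comm]
    rw [this]
    refine Real.rpow_le_rpow (by positivity) ?_ (by positivity)
    calc (k.factorial : ℝ) ≤ (k : ℝ) ^ k := by exact_mod_cast Nat.factorial_le_pow k
      _ ≤ _ := by gcongr; linarith
  rw [e1]
  calc K * (C * (Real.exp B ^ k * Real.exp B)) / R ^ k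
      = K * Real.exp B * C * (Real.exp B ^ k / R ^ k) := by ring
    _ ≤ _ := by gcongr

/-! ### Estimates for star products -/

theorem exists_norm_mul_le (n : ℕ) : ∃ K > 0, ∀ a b : Cl n, ‖a * b‖ ≤ K * ‖a‖ * ‖b‖ := by
  refine ⟨‖(LinearMap.mul ℝ (Cl n)).toContinuousBilinearMap‖ + 1, by positivity, fun a b => ?_⟩
  refine ((LinearMap.mul ℝ (Cl n)).toContinuousBilinearMap.le_opNorm₂ a b).trans ?_
  gcongr
  linarith

/-- The binomial coefficient is at most `2^(k+m)`, and an exponent `s ≤ 1` does not increase this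
power of two. -/
theorem factorial_add_rpow_le {s : ℝ} (hs0 : 0 ≤ s) (hs1 : s ≤ 1) (k m : ℕ) :
    ((k + m).factorial : ℝ) ^ s ≤
      2 ^ (k + m) * (k.factorial : ℝ) ^ s * (m.factorial : ℝ) ^ s := by
  have h1 : ((k + m).factorial : ℝ) ≤ 2 ^ (k + m) * k.factorial * m.factorial := by
    rw [← Nat.add_choose_mul_factorial_mul_factorial k m]
    push_cast
    gcongr
    exact_mod_cast Nat.choose_le_two_pow (k + m) _
  refine (Real.rpow_le_rpow (by positivity) h1 hs0).trans ?_
  rw [Real.mul_rpow (by positivity) (by positivity), Real.mul_rpow (by positivity) (by positivity)]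
  gcongr
  exact (Real.rpow_le_rpow_of_exponent_le (one_le_pow₀ (by norm_num)) hs1).trans
    (Real.rpow_one _).le

/-- The cost of `m` derivatives on coefficients of type `E^k / (k!)^(1/p)`: splitting
`((k+m)!)^(1-1/p)` isolates `(m!)^(1-1/p)`, the weight that `CoeffGrowth` compensates, and restores
the decay in `k`. -/
theorem factorial_div_mul_le {p E : ℝ} (hp : 1 ≤ p) (hE : 0 ≤ E) (k m : ℕ) :
    ((k + m).factorial : ℝ) / k.factorial * (E ^ (k + m) / ((k + m).factorial : ℝ) ^ (1 / p)) ≤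
      (2 * E) ^ (k + m) * (m.factorial : ℝ) ^ (1 - 1 / p) / (k.factorial : ℝ) ^ (1 / p) := by
  have hp0 : 0 < p := by linarith
  have h1 : 1 / p ≤ 1 := by rw [div_le_one hp0]; exact hp
  have h0 : 0 ≤ 1 / p := by positivity
  have h := factorial_add_rpow_le (s := 1 - 1 / p) (by linarith) (by linarith) k m
  have hsplit : ∀ i : ℕ, (i.factorial : ℝ) ^ (1 - 1 / p) =
      i.factorial / (i.factorial : ℝ) ^ (1 / p) := fun i => by
    rw [Real.rpow_sub (by positivity), Real.rpow_one]
  rw [hsplit (k + m), hsplit k] at h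
  calc ((k + m).factorial : ℝ) / k.factorial * (E ^ (k + m) / ((k + m).factorial : ℝ) ^ (1 / p))
      = E ^ (k + m) / k.factorial *
          (((k + m).factorial : ℝ) / ((k + m).factorial : ℝ) ^ (1 / p)) := by ring
    _ ≤ E ^ (k + m) / k.factorial * (2 ^ (k + m) *
          ((k.factorial : ℝ) / (k.factorial : ℝ) ^ (1 / p)) *
          (m.factorial : ℝ) ^ (1 - 1 / p)) := by gcongr
    _ = _ := by
      rw [mul_pow]
      have : (k.factorial : ℝ) ≠ 0 := by positivity
      field_simp

/-- Convolution of two sequences of Mittag-Leffler type. -/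
theorem sum_pow_div_factorial_le {p a b : ℝ} (hp : 1 ≤ p) (ha : 0 ≤ a) (hb : 0 ≤ b) (l : ℕ) :
    ∑ k ∈ Finset.range (l + 1), (a ^ k / (k.factorial : ℝ) ^ (1 / p)) *
        (b ^ (l - k) / ((l - k).factorial : ℝ) ^ (1 / p)) ≤
      (4 * (a + b)) ^ l / (l.factorial : ℝ) ^ (1 / p) := by
  have hp0 : 0 < p := by linarith
  have h1 : 1 / p ≤ 1 := by rw [div_le_one hp0]; exact hp
  have hterm : ∀ k ∈ Finset.range (l + 1), (a ^ k / (k.factorial : ℝ) ^ (1 / p)) *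
        (b ^ (l - k) / ((l - k).factorial : ℝ) ^ (1 / p)) ≤
      (2 * (a + b)) ^ l / (l.factorial : ℝ) ^ (1 / p) := by
    intro k hk
    obtain ⟨j, rfl⟩ := Nat.exists_eq_add_of_le (Nat.lt_succ_iff.1 (Finset.mem_range.1 hk))
    have h := factorial_add_rpow_le (s := 1 / p) (by positivity) h1 k j
    rw [Nat.add_sub_cancel_left, div_mul_div_comm, div_le_div_iff₀ (by positivity) (by positivity)]
    calc a ^ k * b ^ j * ((k + j).factorial : ℝ) ^ (1 / p)
        ≤ ((a + b) ^ k * (a + b) ^ j) *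
          (2 ^ (k + j) * (k.factorial : ℝ) ^ (1 / p) * (j.factorial : ℝ) ^ (1 / p)) := by
          gcongr <;> linarith
      _ = _ := by rw [mul_pow]; ring
  refine (Finset.sum_le_sum hterm).trans ?_
  rw [Finset.sum_const, Finset.card_range, nsmul_eq_mul]
  -- The number of terms contributes a second factor `2^l`, whence the `4`.
  have h2 : ((l + 1 : ℕ) : ℝ) ≤ 2 ^ l := by exact_mod_cast Nat.lt_two_pow_self (n := l)
  calc ((l + 1 : ℕ) : ℝ) * ((2 * (a + b)) ^ l / (l.factorial : ℝ) ^ (1 / p))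
      ≤ 2 ^ l * ((2 * (a + b)) ^ l / (l.factorial : ℝ) ^ (1 / p)) := by gcongr
    _ = _ := by rw [← mul_div_assoc, ← mul_pow]; ring_nf

/-- The central estimate. `K` and `G` depend on `E` but not on `f`, and the bound is linear in `A`;
this uniformity later gives continuity. -/
theorem exists_norm_starCoeff_le {n : ℕ} (hn : 1 ≤ n) {M : Pv n →L[ℝ] Cl n →L[ℝ] Cl n}
    (hM : IsParavectorAction M) {p : ℝ} (hp : 1 ≤ p) {u : ℕ → Pv n → Cl n}
    (hu : ∀ m, IsSliceMonogenic M (u m)) (hg : CoeffGrowth p u) {E : ℝ} (hE : 0 < E) :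
    ∃ K > 0, ∃ G > 0, ∀ f : Pv n → Cl n, ∀ A : ℝ, 0 ≤ A →
      (∀ k, ‖taylorCoeff f k‖ ≤ A * (E ^ k / (k.factorial : ℝ) ^ (1 / p))) →
      ∀ m l, ‖starCoeff (u m) (partialX0^[m] f) l‖ ≤
        K * A * (1 / 2) ^ m * (G ^ l / (l.factorial : ℝ) ^ (1 / p)) := by
  obtain ⟨K₁, hK₁, hT⟩ := exists_norm_taylorCoeff_le_of_exp hn hM hp
  obtain ⟨K₂, hK₂, hmul⟩ := exists_norm_mul_le n
  obtain ⟨B, hB, hg⟩ := hg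
  -- The derivatives of `f` cost `(2E)^m`, so this `ε` leaves `ε^m (2E)^m = (1/2)^m`.
  obtain ⟨C, hC, hg⟩ := hg (1 / (4 * E)) (by positivity)
  set D := Real.exp B
  have hD : 0 < D := Real.exp_pos B
  refine ⟨K₂ * (K₁ * D * C), by positivity, 4 * (D + 2 * E), by positivity,
    fun f A hA hf m l => ?_⟩
  have ha : ∀ k, ‖taylorCoeff (u m) k‖ ≤ K₁ * D *
      (C * ((1 / (4 * E)) ^ m / (m.factorial : ℝ) ^ (1 - 1 / p))) *
      (D ^ k / (k.factorial : ℝ) ^ (1 / p)) :=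
    hT (u m) (hu m) B _ (by positivity) (hg m)
  have hb : ∀ k, ‖taylorCoeff (partialX0^[m] f) k‖ ≤
      A * ((2 * E) ^ (k + m) * (m.factorial : ℝ) ^ (1 - 1 / p) /
        (k.factorial : ℝ) ^ (1 / p)) := by
    intro k
    rw [taylorCoeff_partialX0_iterate, norm_smul, Real.norm_of_nonneg (by positivity)]
    calc _ ≤ ((k + m).factorial : ℝ) / k.factorial *
          (A * (E ^ (k + m) / ((k + m).factorial : ℝ) ^ (1 / p))) := by
          gcongr; exact hf _
      _ = A * (((k + m).factorial : ℝ) / k.factorial *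
          (E ^ (k + m) / ((k + m).factorial : ℝ) ^ (1 / p))) := by ring
      _ ≤ _ := by gcongr; exact factorial_div_mul_le hp hE.le k m
  have hm : (0 : ℝ) < (m.factorial : ℝ) ^ (1 - 1 / p) := by positivity
  have hpow : (1 / (4 * E)) ^ m * (2 * E) ^ m = (1 / 2) ^ m := by
    rw [← mul_pow]
    congr 1
    field_simp
    norm_num
  calc ‖starCoeff (u m) (partialX0^[m] f) l‖
      ≤ ∑ k ∈ Finset.range (l + 1),
          ‖taylorCoeff (u m) k * taylorCoeff (partialX0^[m] f) (l - k)‖ := norm_sum_le _ _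
    _ ≤ ∑ k ∈ Finset.range (l + 1), K₂ * (K₁ * D * C) * A * (1 / 2) ^ m *
          ((D ^ k / (k.factorial : ℝ) ^ (1 / p)) *
            ((2 * E) ^ (l - k) / ((l - k).factorial : ℝ) ^ (1 / p))) := by
        refine Finset.sum_le_sum fun k _ => ?_
        calc _ ≤ K₂ * ‖taylorCoeff (u m) k‖ * ‖taylorCoeff (partialX0^[m] f) (l - k)‖ :=
              hmul _ _
          _ ≤ K₂ * (K₁ * D * (C * ((1 / (4 * E)) ^ m / (m.factorial : ℝ) ^ (1 - 1 / p))) *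
                (D ^ k / (k.factorial : ℝ) ^ (1 / p))) *
              (A * ((2 * E) ^ (l - k + m) * (m.factorial : ℝ) ^ (1 - 1 / p) /
                ((l - k).factorial : ℝ) ^ (1 / p))) := by
              gcongr
              · exact ha k
              · exact hb (l - k)
          _ = _ := by
              rw [← hpow, pow_add]
              -- The power of `m!` lost by differentiating cancels the one gained from `u m`.
              set q := (m.factorial : ℝ) ^ (1 - 1 / p)
              have : q / q = 1 := div_self hm.ne'
              linear_combination (K₂ * (K₁ * D * C) * A * (1 / (4 * E)) ^ m * (2 * E) ^ m *
                ((D ^ k / (k.factorial : ℝ) ^ (1 / p)) *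
                  ((2 * E) ^ (l - k) / ((l - k).factorial : ℝ) ^ (1 / p)))) * this
    _ ≤ _ := by
        rw [← Finset.mul_sum]
        gcongr
        exact sum_pow_div_factorial_le hp hD.le (by positivity) l

/-! ### Infinite order differential operators -/

/-- The operator `f ↦ ∑_m u_m ⋆ ∂_{x₀}^m f` for the star product of the action `M`. -/
def actionOp {n : ℕ} (M : Pv n →L[ℝ] Cl n →L[ℝ] Cl n) (u : ℕ → Pv n → Cl n) (f : Pv n → Cl n)
    (x : Pv n) : Cl n :=
  ∑' m, ∑' l, (M x ^ l) (starCoeff (u m) (partialX0^[m] f) l)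

theorem opL_eq {n : ℕ} (u : ℕ → Pv n → Cl n) (f : Pv n → Cl n) :
    opL u f = actionOp (leftAction n) u f := by
  funext x
  simp only [opL, starProdL, actionOp, leftAction_pow_apply]

theorem opR_eq {n : ℕ} (u : ℕ → Pv n → Cl n) (f : Pv n → Cl n) :
    opR u f = actionOp (rightAction n) u f := by
  funext x
  simp only [opR, starProdR, actionOp, rightAction_pow_apply]

/-! ### Double series with geometric decay in `m` and factorial decay in `l` -/

section DoubleSeries

variable {n : ℕ} (M : Pv n →L[ℝ] Cl n →L[ℝ] Cl n) {p K G : ℝ} {c : ℕ → ℕ → Cl n}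

theorem norm_action_pow_le_of_norm_le
    (hc : ∀ m l, ‖c m l‖ ≤ K * (1 / 2) ^ m * (G ^ l / (l.factorial : ℝ) ^ (1 / p)))
    (x : Pv n) (m l : ℕ) :
    ‖(M x ^ l) (c m l)‖ ≤ (K * (1 / 2) ^ m) *
      ((‖M‖ * ‖x‖ * G) ^ l / (l.factorial : ℝ) ^ (1 / p)) := by
  refine (norm_action_pow_apply_le M x l _).trans ?_
  calc (‖M‖ * ‖x‖) ^ l * ‖c m l‖
      ≤ (‖M‖ * ‖x‖) ^ l * (K * (1 / 2) ^ m * (G ^ l / (l.factorial : ℝ) ^ (1 / p))) := by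
        gcongr; exact hc m l
    _ = _ := by rw [mul_pow _ G]; ring

theorem summable_action_pow_prod (hp : 1 ≤ p) (hK : 0 ≤ K) (hG : 0 ≤ G)
    (hc : ∀ m l, ‖c m l‖ ≤ K * (1 / 2) ^ m * (G ^ l / (l.factorial : ℝ) ^ (1 / p)))
    (x : Pv n) : Summable fun ml : ℕ × ℕ => (M x ^ ml.2) (c ml.1 ml.2) := by
  refine Summable.of_norm_bounded ?_ fun ml => norm_action_pow_le_of_norm_le M hc x ml.1 ml.2
  exact Summable.mul_of_nonneg (summable_geometric_two.mul_left K)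
    (summable_pow_div_factorial_rpow hp (by positivity)) (fun m => by positivity)
    (fun l => by positivity)

theorem norm_tsum_action_pow_le (hp : 1 ≤ p) (hK : 0 ≤ K) (hG : 0 ≤ G)
    (hc : ∀ m l, ‖c m l‖ ≤ K * (1 / 2) ^ m * (G ^ l / (l.factorial : ℝ) ^ (1 / p)))
    (x : Pv n) :
    ‖∑' m, ∑' l, (M x ^ l) (c m l)‖ ≤
      4 * K * Real.exp (((2 * (‖M‖ * G)) ^ p / p) * ‖x‖ ^ p) := by
  set t := ‖M‖ * ‖x‖ * G
  have ht : 0 ≤ t := by positivity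
  have h1 : ∀ m, ‖∑' l, (M x ^ l) (c m l)‖ ≤
      K * (1 / 2) ^ m * (2 * Real.exp ((2 * t) ^ p / p)) := fun m => by
    refine (tsum_of_norm_bounded ((summable_pow_div_factorial_rpow hp ht).hasSum.mul_left _)
      (norm_action_pow_le_of_norm_le M hc x m)).trans ?_
    gcongr
    exact tsum_pow_div_factorial_rpow_le hp ht
  -- The geometric sum gives a factor `2` and the inner series another, whence `4 * K`.
  refine (tsum_of_norm_bounded ((hasSum_geometric_two.mul_left K).mul_right _) h1).trans ?_
  have : (2 * t) ^ p / p = ((2 * (‖M‖ * G)) ^ p / p) * ‖x‖ ^ p := by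
    have : 2 * t = 2 * (‖M‖ * G) * ‖x‖ := by ring
    rw [this, Real.mul_rpow (by positivity) (by positivity)]
    ring
  rw [this]
  exact le_of_eq (by ring)

/-- Absolute convergence allows summing over `m` first. The result is a single power series with
coefficients `∑' m, c m l`, which keep the decay in `l` and so have infinite radius of convergence.
-/
theorem isSliceMonogenic_tsum_tsum (hM : IsParavectorAction M) (hp : 1 ≤ p) (hK : 0 ≤ K)
    (hG : 0 ≤ G)
    (hc : ∀ m l, ‖c m l‖ ≤ K * (1 / 2) ^ m * (G ^ l / (l.factorial : ℝ) ^ (1 / p))) :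
    IsSliceMonogenic M fun x => ∑' m, ∑' l, (M x ^ l) (c m l) := by
  have hsum : ∀ l, Summable fun m => c m l := fun l =>
    Summable.of_norm_bounded ((summable_geometric_two.mul_left K).mul_right _) fun m => hc m l
  have heq : (fun x => ∑' m, ∑' l, (M x ^ l) (c m l)) =
      fun x => ∑' l, (M x ^ l) (∑' m, c m l) := by
    funext x
    have hs : Summable (Function.uncurry fun m l => (M x ^ l) (c m l)) :=
      summable_action_pow_prod M hp hK hG hc x
    exact hs.tsum_comm.symm.trans (tsum_congr fun l => ((M x ^ l).map_tsum (hsum l)).symm)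
  rw [heq]
  refine isSliceMonogenic_tsum hM fun r hr => ?_
  refine Summable.of_nonneg_of_le (fun l => by positivity) (fun l => ?_)
    ((summable_pow_div_factorial_rpow (p := p) (t := r * G) hp (by positivity)).mul_left (K * 2))
  calc r ^ l * ‖∑' m, c m l‖
      ≤ r ^ l * (K * 2 * (G ^ l / (l.factorial : ℝ) ^ (1 / p))) := by
        gcongr
        exact tsum_of_norm_bounded ((hasSum_geometric_two.mul_left K).mul_right _)
          fun m => hc m l
    _ = _ := by rw [mul_pow]; ring

end DoubleSeries

/-- Quantitative form of the mapping properties of `actionOp M u`. -/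
theorem exists_actionOp_bound {n : ℕ} (hn : 1 ≤ n) {M : Pv n →L[ℝ] Cl n →L[ℝ] Cl n}
    (hM : IsParavectorAction M) {p : ℝ} (hp : 1 ≤ p) {u : ℕ → Pv n → Cl n}
    (hu : ∀ m, IsSliceMonogenic M (u m)) (hg : CoeffGrowth p u) (B : ℝ) :
    ∃ K > 0, ∃ B' > 0, ∀ f : Pv n → Cl n, IsSliceMonogenic M f → ∀ C : ℝ, 0 ≤ C →
      (∀ x, ‖f x‖ ≤ C * Real.exp (B * ‖x‖ ^ p)) →
      (∀ x, Summable fun ml : ℕ × ℕ =>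
        (M x ^ ml.2) (starCoeff (u ml.1) (partialX0^[ml.1] f) ml.2)) ∧
      IsSliceMonogenic M (actionOp M u f) ∧
      ∀ x, ‖actionOp M u f x‖ ≤ K * C * Real.exp (B' * ‖x‖ ^ p) := by
  have hp0 : 0 < p := by linarith
  obtain ⟨K₁, hK₁, hT⟩ := exists_norm_taylorCoeff_le_of_exp hn hM hp
  obtain ⟨K, hK, G, hG, hs⟩ := exists_norm_starCoeff_le hn hM hp hu hg (Real.exp_pos B)
  -- Both constants are fixed before `f` and `C`. The `+ 1` makes the exponent positive without
  -- knowing `M ≠ 0`.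
  refine ⟨4 * (K * (K₁ * Real.exp B)), by positivity, (2 * (‖M‖ * G)) ^ p / p + 1,
    by positivity, fun f hf C hC hb => ?_⟩
  have hK' : 0 ≤ K * (K₁ * Real.exp B * C) := by positivity
  obtain ⟨c, hc⟩ : ∃ c : ℕ → ℕ → Cl n, ∀ m l, starCoeff (u m) (partialX0^[m] f) l = c m l :=
    ⟨_, fun _ _ => rfl⟩
  have hop : actionOp M u f = fun x => ∑' m, ∑' l, (M x ^ l) (c m l) := by
    funext x
    simp only [actionOp, hc]
  have hb' : ∀ m l, ‖c m l‖ ≤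
      K * (K₁ * Real.exp B * C) * (1 / 2) ^ m * (G ^ l / (l.factorial : ℝ) ^ (1 / p)) := by
    intro m l
    rw [← hc]
    exact hs f _ (by positivity) (hT f hf B C hC hb) m l
  simp only [hop, hc]
  refine ⟨summable_action_pow_prod M hp hK' hG.le hb',
    isSliceMonogenic_tsum_tsum M hM hp hK' hG.le hb', fun x => ?_⟩
  refine (norm_tsum_action_pow_le M hp hK' hG.le hb' x).trans ?_
  calc _ = 4 * (K * (K₁ * Real.exp B)) * C *
        Real.exp (((2 * (‖M‖ * G)) ^ p / p) * ‖x‖ ^ p) := by ring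
    _ ≤ _ := by gcongr; linarith

/-- The space of slice monogenic functions of exponential growth for the action `M`. -/
def SM {n : ℕ} (M : Pv n →L[ℝ] Cl n →L[ℝ] Cl n) (p : ℝ) : Set (Pv n → Cl n) :=
  {f | IsSliceMonogenic M f ∧ HasExpGrowth p f}

theorem zero_mem_SM {n : ℕ} (M : Pv n →L[ℝ] Cl n →L[ℝ] Cl n) (p : ℝ) : 0 ∈ SM M p :=
  ⟨IsSliceMonogenic.zero M, 1, one_pos, 1, one_pos, fun x => by simp [Real.exp_nonneg]⟩

theorem starCoeff_sub {n : ℕ} (hn : 1 ≤ n) {M : Pv n →L[ℝ] Cl n →L[ℝ] Cl n}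
    {f g : Pv n → Cl n} (hf : IsSliceMonogenic M f) (hg : IsSliceMonogenic M g)
    (w : Pv n → Cl n) (m l : ℕ) :
    starCoeff w (partialX0^[m] (f - g)) l =
      starCoeff w (partialX0^[m] f) l - starCoeff w (partialX0^[m] g) l := by
  simp only [starCoeff, taylorCoeff_partialX0_iterate, hf.taylorCoeff_sub hn hg, smul_sub, mul_sub,
    Finset.sum_sub_distrib]

theorem actionOp_zero {n : ℕ} (M : Pv n →L[ℝ] Cl n →L[ℝ] Cl n) (u : ℕ → Pv n → Cl n) :
    actionOp M u 0 = 0 := by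
  funext x
  simp [actionOp, starCoeff, taylorCoeff_partialX0_iterate, taylorCoeff_zero]

/-! ### Mapping properties and continuity on `SM M p` -/

section Operator

variable {n : ℕ} (hn : 1 ≤ n) {M : Pv n →L[ℝ] Cl n →L[ℝ] Cl n} (hM : IsParavectorAction M)
  {p : ℝ} (hp : 1 ≤ p) {u : ℕ → Pv n → Cl n} (hu : ∀ m, IsSliceMonogenic M (u m))
  (hg : CoeffGrowth p u)

include hn hM hp hu hg

theorem summable_prod_of_mem_SM {f : Pv n → Cl n} (hf : f ∈ SM M p) (x : Pv n) :
    Summable fun ml : ℕ × ℕ => (M x ^ ml.2) (starCoeff (u ml.1) (partialX0^[ml.1] f) ml.2) := by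
  obtain ⟨hf, B, -, C, hC, hb⟩ := hf
  obtain ⟨K, hK, B', hB', h⟩ := exists_actionOp_bound hn hM hp hu hg B
  exact (h f hf C hC.le hb).1 x

theorem actionOp_mem_SM {f : Pv n → Cl n} (hf : f ∈ SM M p) : actionOp M u f ∈ SM M p := by
  obtain ⟨hf, B, -, C, hC, hb⟩ := hf
  obtain ⟨K, hK, B', hB', h⟩ := exists_actionOp_bound hn hM hp hu hg B
  obtain ⟨-, h1, h2⟩ := h f hf C hC.le hb
  exact ⟨h1, B', hB', K * C, by positivity, h2⟩

theorem actionOp_sub {f g : Pv n → Cl n} (hf : f ∈ SM M p) (hf' : g ∈ SM M p) (x : Pv n) :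
    actionOp M u (f - g) x = actionOp M u f x - actionOp M u g x := by
  have s1 := summable_prod_of_mem_SM hn hM hp hu hg hf x
  have s2 := summable_prod_of_mem_SM hn hM hp hu hg hf' x
  simp only [actionOp]
  rw [← s1.prod.tsum_sub s2.prod]
  congr 1
  funext m
  rw [← (s1.prod_factor m).tsum_sub (s2.prod_factor m)]
  congr 1
  funext l
  rw [starCoeff_sub hn hf.1 hf'.1, map_sub]

/-- The uniform bound is applied to `F k - g`, with the weighted supremum `δ k` itself as the
constant `C`; the weighted supremum of the images is then at most `K * δ k`. -/
theorem tendstoSM_actionOp {F : ℕ → Pv n → Cl n} {g : Pv n → Cl n} (hF : ∀ k, F k ∈ SM M p)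
    (hf' : g ∈ SM M p) (h : TendstoSM p F g) :
    TendstoSM p (fun k => actionOp M u (F k)) (actionOp M u g) := by
  obtain ⟨B, hB, h⟩ := h
  obtain ⟨K, hK, B', hB', hop⟩ := exists_actionOp_bound hn hM hp hu hg B
  refine ⟨B', hB', ?_⟩
  set δ : ℕ → ENNReal := fun k => ⨆ x, ‖Real.exp (-(B * ‖x‖ ^ p)) • (F k x - g x)‖ₑ
  have h2 : Tendsto (fun k => ENNReal.ofReal K * δ k) atTop (𝓝 0) := by
    simpa using ENNReal.Tendsto.const_mul h (Or.inr ENNReal.ofReal_ne_top)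
  refine tendsto_of_tendsto_of_tendsto_of_le_of_le' tendsto_const_nhds h2
    (Eventually.of_forall fun k => zero_le) ?_
  -- The supremum may be infinite for finitely many `k`; only a finite one is a real constant to
  -- which the bound applies.
  filter_upwards [h.eventually_lt_const ENNReal.zero_lt_top] with k hk
  have hb : ∀ x, ‖(F k - g) x‖ ≤ (δ k).toReal * Real.exp (B * ‖x‖ ^ p) := by
    intro x
    have h3 : ‖Real.exp (-(B * ‖x‖ ^ p)) • (F k x - g x)‖ₑ ≤ δ k :=
      le_iSup (fun x => ‖Real.exp (-(B * ‖x‖ ^ p)) • (F k x - g x)‖ₑ) x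
    have h4 := ENNReal.toReal_mono hk.ne h3
    rw [toReal_enorm, norm_smul, Real.norm_of_nonneg (Real.exp_nonneg _), Real.exp_neg,
      inv_mul_le_iff₀ (Real.exp_pos _)] at h4
    rw [Pi.sub_apply, mul_comm]
    exact h4
  have h5 := (hop (F k - g) ((hF k).1.sub hf'.1) _ ENNReal.toReal_nonneg hb).2.2
  refine iSup_le fun x => ?_
  rw [← actionOp_sub hn hM hp hu hg (hF k) hf', ← ENNReal.ofReal_toReal hk.ne,
    ← ENNReal.ofReal_mul hK.le, ← ofReal_norm]
  refine ENNReal.ofReal_le_ofReal ?_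
  rw [norm_smul, Real.norm_of_nonneg (Real.exp_nonneg _), Real.exp_neg,
    inv_mul_le_iff₀ (Real.exp_pos _), mul_comm]
  exact h5 x

end Operator

/-! ### Specialization to left and right multiplication -/

theorem SML_eq (n : ℕ) (p : ℝ) : SML n p = SM (leftAction n) p := rfl

theorem SMR_eq (n : ℕ) (p : ℝ) : SMR n p = SM (rightAction n) p := rfl

end

end SliceMonogenic

theorem theorem3p2 (n : ℕ) (hn : 1 ≤ n) (p : ℝ) (hp : 1 ≤ p) :
    (∀ u ∈ DL n p,
      (∀ f ∈ SML n p,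
        (∀ x : Pv n,
          (∀ m : ℕ, Summable fun l : ℕ => toCl x ^ l * starCoeff (u m) (partialX0^[m] f) l) ∧
          Summable fun m : ℕ => starProdL (u m) (partialX0^[m] f) x) ∧
        opL u f ∈ SML n p) ∧
      (∀ F : ℕ → Pv n → Cl n, (∀ k, F k ∈ SML n p) → TendstoSM p F 0 →
        TendstoSM p (fun k => opL u (F k)) 0) ∧
      (∀ (F : ℕ → Pv n → Cl n) (g : Pv n → Cl n), (∀ k, F k ∈ SML n p) → g ∈ SML n p →
        TendstoSM p F g → TendstoSM p (fun k => opL u (F k)) (opL u g))) ∧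
    (∀ u ∈ DR n p,
      (∀ f ∈ SMR n p,
        (∀ x : Pv n,
          (∀ m : ℕ, Summable fun l : ℕ => starCoeff (u m) (partialX0^[m] f) l * toCl x ^ l) ∧
          Summable fun m : ℕ => starProdR (u m) (partialX0^[m] f) x) ∧
        opR u f ∈ SMR n p) ∧
      (∀ F : ℕ → Pv n → Cl n, (∀ k, F k ∈ SMR n p) → TendstoSM p F 0 →
        TendstoSM p (fun k => opR u (F k)) 0) ∧
      (∀ (F : ℕ → Pv n → Cl n) (g : Pv n → Cl n), (∀ k, F k ∈ SMR n p) → g ∈ SMR n p →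
        TendstoSM p F g → TendstoSM p (fun k => opR u (F k)) (opR u g))) := by
  constructor
  · intro u hu
    have hM := isParavectorAction_leftAction n
    obtain ⟨hu, hg⟩ := hu
    rw [SML_eq]
    have hc := fun (F : ℕ → Pv n → Cl n) (g : Pv n → Cl n) hF hf' h =>
      tendstoSM_actionOp (F := F) (g := g) hn hM hp hu hg hF hf' h
    simp only [opL_eq]
    refine ⟨fun f hf => ⟨fun x => ?_, actionOp_mem_SM hn hM hp hu hg hf⟩, fun F hF h => ?_, hc⟩
    · have hs := summable_prod_of_mem_SM hn hM hp hu hg hf x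
      simp only [starProdL, ← leftAction_pow_apply]
      exact ⟨hs.prod_factor, hs.prod⟩
    -- Continuity at `0` is the general statement with limit `0`, because the operator maps `0` to
    -- `0`.
    · simpa only [actionOp_zero] using hc F 0 hF (zero_mem_SM _ p) h
  · intro u hu
    have hM := isParavectorAction_rightAction n
    obtain ⟨hu, hg⟩ := hu
    rw [SMR_eq]
    have hc := fun (F : ℕ → Pv n → Cl n) (g : Pv n → Cl n) hF hf' h =>
      tendstoSM_actionOp (F := F) (g := g) hn hM hp hu hg hF hf' h
    simp only [opR_eq]
    refine ⟨fun f hf => ⟨fun x => ?_, actionOp_mem_SM hn hM hp hu hg hf⟩, fun F hF h => ?_, hc⟩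
    · have hs := summable_prod_of_mem_SM hn hM hp hu hg hf x
      simp only [starProdR, ← rightAction_pow_apply]
      exact ⟨hs.prod_factor, hs.prod⟩
    · simpa only [actionOp_zero] using hc F 0 hF (zero_mem_SM _ p) h
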